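/- For $N\ge 1$, a frequency vector $\omega\in\mathbb{R}^N$ and a coupling strength $\gamma\ge 0$ consider the Kuramoto system \[ \dot\theta_i=\omega_i+\frac{\gamma}{N}\sum_{j=1}^N\sin(\theta_j-\theta_i),\qquad i=1,\dots,N. \tag{K} \] A solution is phase-locked if all differences $\theta_i(t)-\theta_j(t)$ are constant in time. A phase-locked solution is stable if the Jacobian of the right-hand side along it has a simple zero eigenvalue (with eigenvector $(1,\dots,1)$) and $N-1$ strictly negative eigenvalues, and the solution is asymptotically orbitally stable: solutions that start close to it remain close to it up to a common rotation of all phases, and converge to it up to a constant common rotation. Let $\omega_1,\omega_2,\dots$ be i.i.d. real random variables, let $M_N=\max_{i\le N}\omega_i-\min_{i\le N}\omega_i$ be the sample range, and suppose that their law is min-max concentrated with scale $(\xi_N)$, i.e. $(\xi_N)$ is a real sequence with $M_N/\xi_N\to 1$ in probability. Let $\gamma_N\ge 0$ be any sequence of coupling strengths, and let $\mathcal P_{\mathrm{sync}}(\gamma_N)$ be the probability that (K) with frequencies $(\omega_1,\dots,\omega_N)$ and coupling strength $\gamma=\gamma_N$ has a stable phase-locked solution. Then \[ \limsup_{N\to\infty}\frac{\gamma_N}{\xi_N}<\frac12\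 \Longrightarrow\ \lim_{N\to\infty}\mathcal P_{\mathrm{sync}}(\gamma_N)=0, \qquad \liminf_{N\to\infty}\frac{\gamma_N}{\xi_N}>1\ \Longrightarrow\ \lim_{N\to\infty}\mathcal P_{\mathrm{sync}}(\gamma_N)=1 . \] Both implications hold as well when $\mathcal P_{\mathrm{sync}}(\gamma_N)$ is the probability that (K) has some phase-locked solution, stable or not. -/

import Mathlib

open Filter Topology MeasureTheory ProbabilityTheory

namespace Kuramoto

/-- The Kuramoto vector field with coupling strength `γ` and frequency vector `ω`:
`θ ↦ (ωᵢ + (γ / N) ∑ⱼ sin (θⱼ - θᵢ))ᵢ`. -/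
noncomputable def field {N : ℕ} (γ : ℝ) (ω θ : Fin N → ℝ) : Fin N → ℝ :=
  fun i => ω i + γ / N * ∑ j, Real.sin (θ j - θ i)

/-- `θ` solves the Kuramoto system for all times. (The field is globally Lipschitz, so every
solution with given initial data extends to all times.) -/
def IsSolution {N : ℕ} (γ : ℝ) (ω : Fin N → ℝ) (θ : ℝ → Fin N → ℝ) : Prop :=
  ∀ t, HasDerivAt θ (field γ ω (θ t)) t

/-- A (completely) phase-locked solution: all phase differences are constant in time. -/
def IsPhaseLocked {N : ℕ} (γ : ℝ) (ω : Fin N → ℝ) (θ : ℝ → Fin N → ℝ) : Prop :=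
  IsSolution γ ω θ ∧ ∀ i j t, θ t i - θ t j = θ 0 i - θ 0 j

/-- Spectral stability of a configuration `θ`: the Jacobian of the field at `θ` has kernel
spanned by `(1, …, 1)` (rotational invariance) and all its other eigenvalues are negative.
The Jacobian is a symmetric matrix, so this says that it has a single zero eigenvalue and
`N - 1` negative ones, with multiplicity. -/
def IsSpectrallyStable {N : ℕ} (γ : ℝ) (ω θ : Fin N → ℝ) : Prop :=
  LinearMap.ker (fderiv ℝ (field γ ω) θ).toLinearMap = Submodule.span ℝ {fun _ => (1 : ℝ)} ∧
  ∀ μ : ℝ, Module.End.HasEigenvalue (fderiv ℝ (field γ ω) θ).toLinearMap μ → μ ≠ 0 → μ < 0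

/-- Asymptotic orbital stability of a solution `θ`: solutions that start near `θ` stay near `θ`
up to a common rotation of all phases, and converge to `θ` up to a constant common rotation. -/
def IsOrbitallyStable {N : ℕ} (γ : ℝ) (ω : Fin N → ℝ) (θ : ℝ → Fin N → ℝ) : Prop :=
  (∀ ε > 0, ∃ δ > 0, ∀ ψ : ℝ → Fin N → ℝ, IsSolution γ ω ψ → ‖ψ 0 - θ 0‖ < δ →
    ∀ t, 0 ≤ t → ∃ c : ℝ, ‖ψ t - θ t - (fun _ => c)‖ < ε) ∧
  (∃ δ > 0, ∀ ψ : ℝ → Fin N → ℝ, IsSolution γ ω ψ → ‖ψ 0 - θ 0‖ < δ →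
    ∃ c : ℝ, Tendsto (fun t => ψ t - θ t) atTop (𝓝 (fun _ => c)))

/-- The frequency vectors for which the system has a phase-locked solution. -/
def lockedSet (N : ℕ) (γ : ℝ) : Set (Fin N → ℝ) :=
  {ω | ∃ θ, IsPhaseLocked γ ω θ}

/-- The frequency vectors for which the system has a stable phase-locked solution. Along a
phase-locked solution the Jacobian is constant, so spectral stability is read at time `0`. -/
def stablyLockedSet (N : ℕ) (γ : ℝ) : Set (Fin N → ℝ) :=
  {ω | ∃ θ, IsPhaseLocked γ ω θ ∧ IsSpectrallyStable γ ω (θ 0) ∧ IsOrbitallyStable γ ω θ}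

/-- The sample range `max xᵢ - min xᵢ`. -/
noncomputable def spread {N : ℕ} (x : Fin N → ℝ) : ℝ :=
  (⨆ i, x i) - ⨅ i, x i

variable {Ω : Type*} [MeasurableSpace Ω]

/-- The random vector of the first `N` variables. -/
def sample (X : ℕ → Ω → ℝ) (N : ℕ) (w : Ω) : Fin N → ℝ :=
  fun i => X i w

/-- Min-max concentration with scale `ξ`: the sample range divided by `ξ N` tends to `1` in
probability. -/
def IsMinMaxConcentrated (P : Measure Ω) (X : ℕ → Ω → ℝ) (ξ : ℕ → ℝ) : Prop :=
  TendstoInMeasure P (fun N w => spread (sample X N w) / ξ N) atTop (fun _ => (1 : ℝ))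

/-- The probability that the system with random frequencies `X 0, …, X (N - 1)` and coupling
strength `γ` has a phase-locked solution. -/
noncomputable def lockProb (P : Measure Ω) (X : ℕ → Ω → ℝ) (N : ℕ) (γ : ℝ) : ENNReal :=
  P {w | sample X N w ∈ lockedSet N γ}

/-- The probability that the system with random frequencies `X 0, …, X (N - 1)` and coupling
strength `γ` has a stable phase-locked solution. -/
noncomputable def stableLockProb (P : Measure Ω) (X : ℕ → Ω → ℝ) (N : ℕ) (γ : ℝ) : ENNReal :=
  P {w | sample X N w ∈ stablyLockedSet N γ}

end Kuramoto

/-! Everything reduces to two deterministic bounds on the sample range `spread ω`. In a phase-locked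
state all components of the field agree, while the coupling term has modulus at most `γ`, so the
range is at most `2γ` (`spread_le_of_mem_lockedSet`). Conversely, a range below `γ` forces a stable
phase-locked state (`mem_stablyLockedSet_of_spread_lt`). Since range over `ξ N` tends to `1` in
probability, these bounds give the thresholds `1/2` and `1`.

For the converse, pass to the frame rotating at the mean frequency and minimise the potential over
centred configurations of diameter at most `π/2`. If the range is below `γ`, the field points
strictly inwards on the boundary (`field_lt_of_sub_eq`), so the minimiser can be moved along the
field without leaving the region. The slope of the energy there is minus the squared length of the
field, which must therefore vanish (`exists_field_eq_zero`). Inside the quarter circle all cosine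
weights are positive: the Jacobian is minus the Laplacian of a weighted complete graph, which gives
spectral stability, and the squared distance modulo rotation is a Lyapunov function, which gives
orbital stability. -/

namespace Kuramoto

/-! ### Antisymmetric double sums and the sample range -/

section Algebra

variable {N : ℕ}

/-- Summation by parts on the complete graph, obtained by swapping the indices. It serves the energy
gradient, the Jacobian's quadratic form and the contraction estimate. -/
lemma sum_sum_antisymm_mul_sub {a : Fin N → Fin N → ℝ} (ha : ∀ i j, a j i = -a i j)
    (v : Fin N → ℝ) :
    ∑ i, ∑ j, a i j * (v j - v i) = -2 * ∑ i, v i * ∑ j, a i j := by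
  have h1 : ∑ i, ∑ j, a i j * v j = -∑ i, ∑ j, a i j * v i := by
    rw [Finset.sum_comm, ← Finset.sum_neg_distrib]
    refine Finset.sum_congr rfl fun i _ => ?_
    rw [← Finset.sum_neg_distrib]
    exact Finset.sum_congr rfl fun j _ => by rw [ha i j]; ring
  have h2 : ∑ i, v i * ∑ j, a i j = ∑ i, ∑ j, a i j * v i := by
    refine Finset.sum_congr rfl fun i _ => ?_
    rw [Finset.mul_sum]
    exact Finset.sum_congr rfl fun j _ => mul_comm _ _
  simp only [mul_sub, Finset.sum_sub_distrib]
  rw [h1, h2]; ring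

lemma sum_sum_antisymm {a : Fin N → Fin N → ℝ} (ha : ∀ i j, a j i = -a i j) :
    ∑ i, ∑ j, a i j = 0 := by
  have := sum_sum_antisymm_mul_sub ha (fun _ => 1)
  simp only [sub_self, mul_zero, Finset.sum_const_zero, one_mul] at this
  linarith

/-- The spectral gap of the complete graph. Its factor `N` cancels the `1 / N` of the coupling. -/
lemma sum_sum_sq_sub {v : Fin N → ℝ} (hv : ∑ i, v i = 0) :
    ∑ i, ∑ j, (v j - v i) ^ 2 = 2 * N * ∑ i, v i ^ 2 := by
  have h := sum_sum_antisymm_mul_sub (a := fun i j => v j - v i) (fun i j => by ring) v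
  simp only [Finset.sum_sub_distrib, hv, Finset.sum_const, Finset.card_univ, Fintype.card_fin,
    nsmul_eq_mul] at h
  simp only [pow_two]
  rw [h, Finset.mul_sum, Finset.mul_sum]
  exact Finset.sum_congr rfl fun i _ => by ring

lemma sin_sub_antisymm (θ : Fin N → ℝ) (i j : Fin N) :
    Real.sin (θ i - θ j) = -Real.sin (θ j - θ i) := by
  rw [← Real.sin_neg, neg_sub]

lemma sum_field (γ : ℝ) (ω θ : Fin N → ℝ) : ∑ i, field γ ω θ i = ∑ i, ω i := by
  simp only [field, Finset.sum_add_distrib, ← Finset.mul_sum]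
  rw [sum_sum_antisymm (fun i j => sin_sub_antisymm θ i j)]
  simp

lemma field_add_const (γ : ℝ) (ω θ : Fin N → ℝ) (c : ℝ) :
    field γ ω (θ + fun _ => c) = field γ ω θ := by
  ext i; simp [field]

/-- The sample range dominates every difference. -/
lemma sub_le_spread (x : Fin N → ℝ) (i j : Fin N) : x i - x j ≤ spread x :=
  sub_le_sub (le_ciSup (Set.finite_range x).bddAbove i) (ciInf_le (Set.finite_range x).bddBelow j)

lemma exists_spread_eq [NeZero N] (x : Fin N → ℝ) : ∃ i j, spread x = x i - x j := by
  obtain ⟨i, hi⟩ := exists_eq_ciSup_of_finite (f := x)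
  obtain ⟨j, hj⟩ := exists_eq_ciInf_of_finite (f := x)
  exact ⟨i, j, by rw [spread, hi, hj]⟩

lemma spread_nonneg (x : Fin N → ℝ) : 0 ≤ spread x := by
  rcases Nat.eq_zero_or_pos N with rfl | h
  · simp [spread]
  · simpa using sub_le_spread x ⟨0, h⟩ ⟨0, h⟩

end Algebra

/-! ### Phase locking bounds the range -/

section Necessity

variable {N : ℕ} {γ : ℝ}

lemma IsPhaseLocked.field_eq {ω : Fin N → ℝ} {θ : ℝ → Fin N → ℝ}
    (h : IsPhaseLocked γ ω θ) (i j : Fin N) : field γ ω (θ 0) i = field γ ω (θ 0) j := by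
  have hd := hasDerivAt_pi.1 (h.1 0)
  have h1 := (hd i).sub (hd j)
  have h2 : HasDerivAt (fun t => θ t i - θ t j) 0 0 := by
    simp_rw [h.2 i j]; exact hasDerivAt_const _ _
  exact sub_eq_zero.1 (h1.unique h2)

lemma abs_coupling_le [NeZero N] (hγ : 0 ≤ γ) (θ : Fin N → ℝ) (i : Fin N) :
    |γ / N * ∑ j, Real.sin (θ j - θ i)| ≤ γ := by
  have hN : (0 : ℝ) < N := Nat.cast_pos.2 (NeZero.pos N)
  have hs : |∑ j, Real.sin (θ j - θ i)| ≤ N := by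
    refine (Finset.abs_sum_le_sum_abs _ _).trans ?_
    refine (Finset.sum_le_sum fun j _ => Real.abs_sin_le_one (θ j - θ i)).trans ?_
    simp
  rw [abs_mul, abs_of_nonneg (by positivity)]
  calc γ / N * |∑ j, Real.sin (θ j - θ i)| ≤ γ / N * N := by gcongr
    _ = γ := by field_simp

/-- Phase locking forces the range of the frequencies to be at most `2γ`. -/
theorem spread_le_of_mem_lockedSet (hγ : 0 ≤ γ) {ω : Fin N → ℝ} (h : ω ∈ lockedSet N γ) :
    spread ω ≤ 2 * γ := by
  rcases Nat.eq_zero_or_pos N with rfl | hN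
  -- Over the empty index type the real supremum and infimum both default to `0`.
  · simpa [spread] using hγ
  have : NeZero N := ⟨hN.ne'⟩
  obtain ⟨θ, hθ⟩ := h
  obtain ⟨i, j, hij⟩ := exists_spread_eq ω
  have h1 := hθ.field_eq i j
  have hi := abs_le.1 (abs_coupling_le hγ (θ 0) i)
  have hj := abs_le.1 (abs_coupling_le hγ (θ 0) j)
  simp only [field] at h1
  linarith [hi.1, hj.2]

end Necessity

/-! ### A locked configuration by energy minimisation -/

section Existence

variable {N : ℕ} {γ : ℝ} {ω : Fin N → ℝ}

/-- On the boundary of the quarter-circle region the field points strictly inwards. -/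
lemma field_lt_of_sub_eq [NeZero N] (hω : ∀ i j, ω i - ω j < γ) {θ : Fin N → ℝ}
    (hθ : ∀ i j, θ i - θ j ≤ Real.pi / 2) {i j : Fin N} (hij : θ i - θ j = Real.pi / 2) :
    field γ ω θ i < field γ ω θ j := by
  have hN : (0 : ℝ) < N := Nat.cast_pos.2 (NeZero.pos N)
  have hγ : 0 < γ := by simpa using hω i i
  -- With `x = θ k - θ j` in `[0, π/2]` the left side is `-(cos x + sin x)`, and `(cos x + sin x)² =
  -- 1 + 2 sin x cos x ≥ 1`.
  have hk : ∀ k, Real.sin (θ k - θ i) - Real.sin (θ k - θ j) ≤ -1 := by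
    intro k
    have hx0 : 0 ≤ θ k - θ j := by linarith [hθ i k]
    have hx1 := hθ k j
    have e : θ k - θ i = (θ k - θ j) - Real.pi / 2 := by linarith
    rw [e, Real.sin_sub_pi_div_two]
    have hs := Real.sin_nonneg_of_nonneg_of_le_pi hx0 (by linarith [Real.pi_pos])
    have hc := Real.cos_nonneg_of_neg_pi_div_two_le_of_le (by linarith [Real.pi_pos]) hx1
    nlinarith [Real.sin_sq_add_cos_sq (θ k - θ j), mul_nonneg hs hc]
  have hsum : ∑ k, Real.sin (θ k - θ i) - ∑ k, Real.sin (θ k - θ j) ≤ -N := by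
    rw [← Finset.sum_sub_distrib]
    refine (Finset.sum_le_sum fun k _ => hk k).trans ?_
    simp
  have h2 : γ / N * (∑ k, Real.sin (θ k - θ i) - ∑ k, Real.sin (θ k - θ j)) ≤ γ / N * (-N) := by
    gcongr
  have h3 : γ / N * (-N : ℝ) = -γ := by field_simp
  have := hω i j
  simp only [field]
  linarith

/-- The potential of the Kuramoto field. -/
noncomputable def energy (γ : ℝ) (ω θ : Fin N → ℝ) : ℝ :=
  -∑ i, ω i * θ i - γ / (2 * N) * ∑ i, ∑ j, Real.cos (θ j - θ i)

lemma continuous_energy (γ : ℝ) (ω : Fin N → ℝ) : Continuous (energy γ ω) := by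
  unfold energy; fun_prop

/-- The Kuramoto field is minus the gradient of the energy. -/
lemma hasDerivAt_energy (γ : ℝ) (ω θ v : Fin N → ℝ) :
    HasDerivAt (fun s : ℝ => energy γ ω (θ + s • v)) (-∑ i, v i * field γ ω θ i) 0 := by
  have hc : ∀ i, HasDerivAt (fun s : ℝ => (θ + s • v) i) (v i) 0 := fun i => by
    simpa using ((hasDerivAt_id (0 : ℝ)).mul_const (v i)).const_add (θ i)
  have h1 : HasDerivAt (fun s : ℝ => ∑ i, ω i * (θ + s • v) i) (∑ i, ω i * v i) 0 :=
    HasDerivAt.fun_sum fun i _ => (hc i).const_mul (ω i)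
  have h2 : HasDerivAt (fun s : ℝ => ∑ i, ∑ j, Real.cos ((θ + s • v) j - (θ + s • v) i))
      (∑ i, ∑ j, -Real.sin (θ j - θ i) * (v j - v i)) 0 :=
    HasDerivAt.fun_sum fun i _ => HasDerivAt.fun_sum fun j _ => by
      simpa using ((hc j).sub (hc i)).cos
  have h3 := h1.neg.sub (h2.const_mul (γ / (2 * N)))
  rw [sum_sum_antisymm_mul_sub (a := fun i j => -Real.sin (θ j - θ i))
    (fun i j => by rw [sin_sub_antisymm θ i j])] at h3
  refine h3.congr_deriv ?_
  have e : ∑ i, v i * field γ ω θ i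
      = ∑ i, ω i * v i + γ / N * ∑ i, v i * ∑ j, Real.sin (θ j - θ i) := by
    rw [Finset.mul_sum, ← Finset.sum_add_distrib]
    exact Finset.sum_congr rfl fun i _ => by simp only [field]; ring
  rw [e]
  simp only [Finset.sum_neg_distrib, mul_neg]
  have : γ / (2 * N) = γ / N / 2 := by rw [mul_comm, div_div]
  rw [this]; ring

/-- The centred configurations contained in a quarter circle. -/
def quarterRegion (N : ℕ) : Set (Fin N → ℝ) :=
  {θ | ∑ i, θ i = 0 ∧ ∀ i j, θ i - θ j ≤ Real.pi / 2}

lemma isCompact_quarterRegion (N : ℕ) [NeZero N] : IsCompact (quarterRegion N) := by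
  have hN : (0 : ℝ) < N := Nat.cast_pos.2 (NeZero.pos N)
  refine Metric.isCompact_of_isClosed_isBounded ?_ ?_
  · have e : quarterRegion N
        = {θ | ∑ i, θ i = 0} ∩ ⋂ i, ⋂ j, {θ | θ i - θ j ≤ Real.pi / 2} := by
      ext θ; simp [quarterRegion]
    rw [e]
    refine (isClosed_eq (by fun_prop) continuous_const).inter ?_
    exact isClosed_iInter fun i => isClosed_iInter fun j =>
      isClosed_le (by fun_prop) continuous_const
  · refine (Metric.isBounded_closedBall (x := (0 : Fin N → ℝ)) (r := Real.pi / 2)).subset ?_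
    rintro θ ⟨h0, hθ⟩
    rw [mem_closedBall_zero_iff, pi_norm_le_iff_of_nonneg (by positivity)]
    intro i
    -- Centring makes each coordinate the average of its differences to the others, so it inherits
    -- their bound.
    have e1 : ∑ j, (θ i - θ j) = N * θ i := by simp [Finset.sum_sub_distrib, h0]
    have e2 : ∑ j, (θ i - θ j) ≤ N * (Real.pi / 2) := by
      simpa using Finset.sum_le_sum fun j (_ : j ∈ Finset.univ) => hθ i j
    have e3 : ∑ j, (θ j - θ i) = -(N * θ i) := by simp [Finset.sum_sub_distrib, h0]
    have e4 : ∑ j, (θ j - θ i) ≤ N * (Real.pi / 2) := by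
      simpa using Finset.sum_le_sum fun j (_ : j ∈ Finset.univ) => hθ j i
    rw [Real.norm_eq_abs, abs_le]
    constructor <;> nlinarith

/-- Slack constraints survive a short step by continuity, tight ones by the inward-pointing
inequality; centring persists because the field sums to `∑ i, ω i = 0`. -/
lemma eventually_mem_quarterRegion [NeZero N] (hω : ∀ i j, ω i - ω j < γ) (h0 : ∑ i, ω i = 0)
    {θ : Fin N → ℝ} (hθ : θ ∈ quarterRegion N) :
    ∀ᶠ s in 𝓝[>] (0 : ℝ), θ + s • field γ ω θ ∈ quarterRegion N := by
  have key : ∀ᶠ s in 𝓝[>] (0 : ℝ), ∀ i j,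
      (θ + s • field γ ω θ) i - (θ + s • field γ ω θ) j ≤ Real.pi / 2 := by
    rw [Filter.eventually_all]; intro i
    rw [Filter.eventually_all]; intro j
    rcases (hθ.2 i j).lt_or_eq with h | h
    · have hc : ContinuousAt
          (fun s : ℝ => (θ + s • field γ ω θ) i - (θ + s • field γ ω θ) j) 0 := by
        simp only [Pi.add_apply, Pi.smul_apply, smul_eq_mul]; fun_prop
      exact nhdsWithin_le_nhds ((hc.eventually_lt continuousAt_const (by simpa using h)).mono
        fun s hs => hs.le)
    · filter_upwards [self_mem_nhdsWithin] with s hs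
      have hs : 0 < s := hs
      have := field_lt_of_sub_eq hω hθ.2 h
      simp only [Pi.add_apply, Pi.smul_apply, smul_eq_mul]
      nlinarith
  filter_upwards [key] with s hs
  refine ⟨?_, hs⟩
  simp only [Pi.add_apply, Pi.smul_apply, smul_eq_mul, Finset.sum_add_distrib, ← Finset.mul_sum,
    sum_field, h0, hθ.1]
  simp

/-- The field itself is an admissible direction at the minimiser, so minus its squared length is a
nonnegative one-sided slope. A zero field then contradicts the strict inequality at any tight
constraint, so the minimiser is interior. -/
lemma exists_field_eq_zero [NeZero N] (hω : ∀ i j, ω i - ω j < γ) (h0 : ∑ i, ω i = 0) :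
    ∃ θ : Fin N → ℝ, (∀ i j, θ i - θ j < Real.pi / 2) ∧ field γ ω θ = 0 := by
  obtain ⟨θ, hθ, hmin⟩ := (isCompact_quarterRegion N).exists_isMinOn
    ⟨0, by simp, fun i j => by simpa using Real.pi_div_two_pos.le⟩ (continuous_energy γ ω).continuousOn
  have hd := (hasDerivAt_energy γ ω θ (field γ ω θ)).tendsto_slope_zero_right
  have hnonneg : 0 ≤ -∑ i, field γ ω θ i * field γ ω θ i := by
    refine ge_of_tendsto hd ?_
    filter_upwards [eventually_mem_quarterRegion hω h0 hθ, self_mem_nhdsWithin] with s hs hs0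
    have hs0 : 0 < s := hs0
    have h1 : energy γ ω θ ≤ energy γ ω (θ + s • field γ ω θ) := hmin hs
    simp only [zero_add, zero_smul, add_zero, smul_eq_mul]
    exact mul_nonneg (inv_nonneg.2 hs0.le) (sub_nonneg.2 h1)
  have hz : ∑ i, field γ ω θ i * field γ ω θ i = 0 :=
    le_antisymm (by linarith) (Finset.sum_nonneg fun i _ => mul_self_nonneg _)
  have hf : field γ ω θ = 0 := by
    ext i
    exact mul_self_eq_zero.1
      ((Finset.sum_eq_zero_iff_of_nonneg fun i _ => mul_self_nonneg _).1 hz i (Finset.mem_univ i))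
  refine ⟨θ, fun i j => (hθ.2 i j).lt_of_ne fun h => ?_, hf⟩
  have := field_lt_of_sub_eq hω hθ.2 h
  simp [hf] at this

/-- If the coupling exceeds the range of the frequencies, some configuration inside a quarter
circle rotates rigidly. -/
theorem exists_field_eq_const [NeZero N] (hω : ∀ i j, ω i - ω j < γ) :
    ∃ (θ : Fin N → ℝ) (m : ℝ), (∀ i j, θ i - θ j < Real.pi / 2) ∧ field γ ω θ = fun _ => m := by
  have hN : (N : ℝ) ≠ 0 := Nat.cast_ne_zero.2 (NeZero.ne N)
  -- Subtracting the mean frequency passes to a rotating frame and leaves frequency differences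
  -- unchanged.
  set m : ℝ := (∑ i, ω i) / N with hm
  obtain ⟨θ, hθ, hf⟩ := exists_field_eq_zero (γ := γ) (ω := fun i => ω i - m)
    (fun i j => by simpa using hω i j)
    (by simp [Finset.sum_sub_distrib, hm]; field_simp; simp)
  refine ⟨θ, m, hθ, ?_⟩
  ext i
  have := congrFun hf i
  simp only [field, Pi.zero_apply] at this ⊢
  linarith

lemma isPhaseLocked_of_field_eq_const {θ : Fin N → ℝ} {m : ℝ}
    (hf : field γ ω θ = fun _ => m) :
    IsPhaseLocked γ ω (fun t => θ + fun _ => m * t) := by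
  refine ⟨fun t => ?_, fun i j t => by simp⟩
  rw [field_add_const, hf, hasDerivAt_pi]
  intro i
  simpa using ((hasDerivAt_id t).const_mul m).const_add (θ i)

end Existence

/-! ### The Jacobian as a graph Laplacian -/

section Spectral

variable {N : ℕ} {γ : ℝ}

lemma fderiv_field_apply (γ : ℝ) (ω θ v : Fin N → ℝ) (i : Fin N) :
    fderiv ℝ (field γ ω) θ v i = γ / N * ∑ j, Real.cos (θ j - θ i) * (v j - v i) := by
  have hdiff : Differentiable ℝ (field γ ω) := by
    unfold field; fun_prop
  have hc : ∀ i, HasDerivAt (fun s : ℝ => (θ + s • v) i) (v i) 0 := fun i => by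
    simpa using ((hasDerivAt_id (0 : ℝ)).mul_const (v i)).const_add (θ i)
  have hline : HasDerivAt (fun s : ℝ => θ + s • v) v 0 := hasDerivAt_pi.2 hc
  have h1 : HasDerivAt (fun s : ℝ => field γ ω (θ + s • v)) (fderiv ℝ (field γ ω) θ v) 0 := by
    have h := (hdiff (θ + (0 : ℝ) • v)).hasFDerivAt.comp_hasDerivAt (0 : ℝ) hline
    rw [zero_smul, add_zero] at h
    exact h
  have h2 : HasDerivAt (fun s : ℝ => field γ ω (θ + s • v) i)
      (γ / N * ∑ j, Real.cos (θ j - θ i) * (v j - v i)) 0 := by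
    refine HasDerivAt.const_add _ (HasDerivAt.const_mul _ (HasDerivAt.fun_sum fun j _ => ?_))
    simpa using ((hc j).sub (hc i)).sin
  exact (hasDerivAt_pi.1 h1 i).unique h2

/-- The quadratic form of the Jacobian is minus the Dirichlet form of a weighted graph. -/
lemma sum_mul_fderiv_field (γ : ℝ) (ω θ v : Fin N → ℝ) :
    ∑ i, v i * fderiv ℝ (field γ ω) θ v i
      = -(γ / N / 2 * ∑ i, ∑ j, Real.cos (θ j - θ i) * (v j - v i) ^ 2) := by
  have h := sum_sum_antisymm_mul_sub (a := fun i j => Real.cos (θ j - θ i) * (v j - v i))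
    (fun i j => by rw [← Real.cos_neg, neg_sub]; ring) v
  have e : ∑ i, ∑ j, Real.cos (θ j - θ i) * (v j - v i) ^ 2
      = ∑ i, ∑ j, Real.cos (θ j - θ i) * (v j - v i) * (v j - v i) := by
    simp only [pow_two, mul_assoc]
  rw [e, h]
  simp only [fderiv_field_apply]
  have e2 : ∑ i, v i * (γ / N * ∑ j, Real.cos (θ j - θ i) * (v j - v i))
      = γ / N * ∑ i, v i * ∑ j, Real.cos (θ j - θ i) * (v j - v i) := by
    rw [Finset.mul_sum]
    exact Finset.sum_congr rfl fun i _ => by ring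
  rw [e2]; ring

lemma cos_sub_pos {θ : Fin N → ℝ} (hθ : ∀ i j, θ i - θ j < Real.pi / 2) (i j : Fin N) :
    0 < Real.cos (θ j - θ i) :=
  Real.cos_pos_of_mem_Ioo ⟨by linarith [hθ i j], hθ j i⟩

/-- Configurations inside a quarter circle are spectrally stable. -/
theorem isSpectrallyStable_of_quarter [NeZero N] (hγ : 0 < γ) (ω : Fin N → ℝ) {θ : Fin N → ℝ}
    (hθ : ∀ i j, θ i - θ j < Real.pi / 2) : IsSpectrallyStable γ ω θ := by
  have hN : (0 : ℝ) < N := Nat.cast_pos.2 (NeZero.pos N)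
  have hterm : ∀ (v : Fin N → ℝ) (i j : Fin N), 0 ≤ Real.cos (θ j - θ i) * (v j - v i) ^ 2 :=
    fun v i j => mul_nonneg (cos_sub_pos hθ i j).le (sq_nonneg _)
  refine ⟨?_, fun μ hμ hμ0 => ?_⟩
  · ext v
    rw [LinearMap.mem_ker, Submodule.mem_span_singleton]
    constructor
    · intro hv
      have hv' : fderiv ℝ (field γ ω) θ v = 0 := hv
      have h := sum_mul_fderiv_field γ ω θ v
      rw [hv'] at h
      have hs : ∑ i, ∑ j, Real.cos (θ j - θ i) * (v j - v i) ^ 2 = 0 := by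
        have hk : 0 < γ / N / 2 := by positivity
        simp only [Pi.zero_apply, mul_zero, Finset.sum_const_zero] at h
        exact (mul_eq_zero.1 (neg_eq_zero.1 h.symm)).resolve_left hk.ne'
      refine ⟨v 0, ?_⟩
      ext j
      -- The graph is complete with positive weights, so the edges at vertex `0` alone force `v` to
      -- be constant.
      have h1 := (Finset.sum_eq_zero_iff_of_nonneg fun i _ =>
        Finset.sum_nonneg fun j _ => hterm v i j).1 hs 0 (Finset.mem_univ _)
      have h2 := (Finset.sum_eq_zero_iff_of_nonneg fun j _ => hterm v 0 j).1 h1 j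
        (Finset.mem_univ _)
      have h3 := pow_eq_zero_iff (two_ne_zero) |>.1
        ((mul_eq_zero.1 h2).resolve_left (cos_sub_pos hθ 0 j).ne')
      simp only [Pi.smul_apply, smul_eq_mul, mul_one]
      linarith
    · rintro ⟨c, rfl⟩
      change fderiv ℝ (field γ ω) θ _ = 0
      ext i
      simp [fderiv_field_apply]
  · obtain ⟨v, hv⟩ := hμ.exists_hasEigenvector
    have hv1 : fderiv ℝ (field γ ω) θ v = μ • v := hv.apply_eq_smul
    have h := sum_mul_fderiv_field γ ω θ v
    rw [hv1] at h
    have hpos : 0 < ∑ i, v i * v i := by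
      obtain ⟨i, hi⟩ := Function.ne_iff.1 hv.2
      exact Finset.sum_pos' (fun i _ => mul_self_nonneg _)
        ⟨i, Finset.mem_univ i, mul_self_pos.2 hi⟩
    have e : ∑ i, v i * (μ • v) i = μ * ∑ i, v i * v i := by
      rw [Finset.mul_sum]
      exact Finset.sum_congr rfl fun i _ => by simp; ring
    have hneg : μ * ∑ i, v i * v i ≤ 0 := by
      rw [← e, h, neg_nonpos]
      exact mul_nonneg (by positivity)
        (Finset.sum_nonneg fun i _ => Finset.sum_nonneg fun j _ => hterm v i j)
    exact lt_of_le_of_ne (by nlinarith) hμ0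

end Spectral

/-! ### Nonlinear orbital stability -/

section Lyapunov

variable {N : ℕ} {γ : ℝ} {ω : Fin N → ℝ}

/-- Mean value inequality: the derivative of `sin` is at least `cos β` on `[-β, β]`. -/
lemma cos_mul_sq_le_sin_sub {β a x : ℝ} (hβ : β ≤ Real.pi / 2) (h1 : |a| ≤ β) (h2 : |a + x| ≤ β) :
    Real.cos β * x ^ 2 ≤ (Real.sin (a + x) - Real.sin a) * x := by
  have hmono : ∀ p q : ℝ, |p| ≤ β → |q| ≤ β → p ≤ q →
      Real.cos β * (q - p) ≤ Real.sin q - Real.sin p := by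
    intro p q hp hq hpq
    refine (convex_Icc (-β) β).mul_sub_le_image_sub_of_le_deriv Real.continuous_sin.continuousOn
      Real.differentiable_sin.differentiableOn (fun y hy => ?_) p (abs_le.1 hp) q (abs_le.1 hq) hpq
    rw [Real.deriv_sin, ← Real.cos_abs y]
    have hy' : |y| ≤ β := abs_le.2 (Set.mem_Icc.1 (interior_subset hy))
    exact Real.cos_le_cos_of_nonneg_of_le_pi (abs_nonneg y) (by linarith [Real.pi_pos]) hy'
  rcases le_total 0 x with hx | hx
  · have := hmono a (a + x) h1 h2 (by linarith)
    rw [add_sub_cancel_left] at this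
    nlinarith
  · have := hmono (a + x) a h2 h1 (by linarith)
    nlinarith

/-- The field contracts centred perturbations of a configuration inside a quarter circle. -/
lemma sum_mul_field_sub_le [NeZero N] (hγ : 0 ≤ γ) {θ u : Fin N → ℝ} {β : ℝ}
    (hβ : β ≤ Real.pi / 2) (hθ : ∀ i j, |θ j - θ i| ≤ β)
    (hu : ∀ i j, |(θ j - θ i) + (u j - u i)| ≤ β) (hu0 : ∑ i, u i = 0) :
    ∑ i, u i * (field γ ω (θ + u) i - field γ ω θ i) ≤ -(γ * Real.cos β) * ∑ i, u i ^ 2 := by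
  have hN : (0 : ℝ) < N := Nat.cast_pos.2 (NeZero.pos N)
  have h := sum_sum_antisymm_mul_sub
    (a := fun i j => Real.sin ((θ j - θ i) + (u j - u i)) - Real.sin (θ j - θ i))
    (fun i j => by
      have e : (θ i - θ j) + (u i - u j) = -((θ j - θ i) + (u j - u i)) := by ring
      rw [e, Real.sin_neg, sin_sub_antisymm θ i j]; ring) u
  have hle : Real.cos β * (2 * N * ∑ i, u i ^ 2)
      ≤ ∑ i, ∑ j, (Real.sin ((θ j - θ i) + (u j - u i)) - Real.sin (θ j - θ i)) * (u j - u i) := by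
    rw [← sum_sum_sq_sub hu0, Finset.mul_sum]
    refine Finset.sum_le_sum fun i _ => ?_
    rw [Finset.mul_sum]
    exact Finset.sum_le_sum fun j _ => cos_mul_sq_le_sin_sub hβ (hθ i j) (hu i j)
  rw [h] at hle
  have e : ∑ i, u i * (field γ ω (θ + u) i - field γ ω θ i) = γ / N *
      ∑ i, u i * ∑ j, (Real.sin ((θ j - θ i) + (u j - u i)) - Real.sin (θ j - θ i)) := by
    rw [Finset.mul_sum]
    refine Finset.sum_congr rfl fun i _ => ?_
    have e1 : ∀ j, (θ + u) j - (θ + u) i = (θ j - θ i) + (u j - u i) := fun j => by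
      simp only [Pi.add_apply]; ring
    simp only [field, e1, Finset.sum_sub_distrib]
    ring
  rw [e]
  have h2 : γ / N * (Real.cos β * (N * ∑ i, u i ^ 2)) ≤ γ / N *
      -(∑ i, u i * ∑ j, (Real.sin ((θ j - θ i) + (u j - u i)) - Real.sin (θ j - θ i))) :=
    mul_le_mul_of_nonneg_left (by linarith) (by positivity)
  have h3 : γ / N * (Real.cos β * (N * ∑ i, u i ^ 2)) = γ * Real.cos β * ∑ i, u i ^ 2 := by
    field_simp
  linarith

/-- A function that decays at rate `k` below the level `r` decays exponentially. -/
lemma le_exp_of_deriv_le {V V' : ℝ → ℝ} (hV : ∀ t, HasDerivAt V (V' t) t) {k r : ℝ} (hk : 0 < k)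
    (hr : 0 < r) (hdecay : ∀ t, V t ≤ r → V' t ≤ -k * V t) (h0 : V 0 ≤ r) {t : ℝ} (ht : 0 ≤ t) :
    V t ≤ r * Real.exp (-(k / 2) * t) := by
  have hB : ∀ s : ℝ, HasDerivAt (fun s => r * Real.exp (-(k / 2) * s))
      (r * (Real.exp (-(k / 2) * s) * -(k / 2))) s := fun s => by
    simpa using (((hasDerivAt_id s).const_mul (-(k / 2))).exp).const_mul r
  -- The comparison needs a strict inequality of derivatives where `V` meets the barrier; hence the
  -- halved rate. The barrier never exceeds `r`, so `hdecay` applies at such a point.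
  refine image_le_of_deriv_right_lt_deriv_boundary (f := V) (f' := V') (a := 0) (b := t)
    (fun s _ => (hV s).continuousAt.continuousWithinAt) (fun s _ => (hV s).hasDerivWithinAt)
    (by simpa using h0) hB (fun s hs heq => ?_) ⟨ht, le_rfl⟩
  have hpos : 0 < r * Real.exp (-(k / 2) * s) := by positivity
  have hle : Real.exp (-(k / 2) * s) ≤ 1 := Real.exp_le_one_iff.2 (by nlinarith [hs.1])
  have := hdecay s (by rw [heq]; nlinarith)
  rw [heq] at this
  nlinarith

lemma abs_le_sqrt_sum_sq (u : Fin N → ℝ) (i : Fin N) : |u i| ≤ √(∑ i, u i ^ 2) :=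
  Real.abs_le_sqrt
    (Finset.single_le_sum (f := fun i => u i ^ 2) (fun _ _ => sq_nonneg _) (Finset.mem_univ i))

lemma norm_le_sqrt_sum_sq (u : Fin N → ℝ) : ‖u‖ ≤ √(∑ i, u i ^ 2) :=
  (pi_norm_le_iff_of_nonneg (Real.sqrt_nonneg _)).2 fun i => abs_le_sqrt_sum_sq u i

/-- Removing the mean only lowers the sum of squares; the factor `N` comes from the sup norm. -/
lemma sum_sq_sub_mean_le [NeZero N] (x : Fin N → ℝ) :
    ∑ i, (x i - (∑ j, x j) / N) ^ 2 ≤ N * ‖x‖ ^ 2 := by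
  have hN : (0 : ℝ) < N := Nat.cast_pos.2 (NeZero.pos N)
  have e : ∑ i, (x i - (∑ j, x j) / N) ^ 2 = ∑ i, x i ^ 2 - (∑ j, x j) ^ 2 / N := by
    simp only [sub_sq, Finset.sum_add_distrib, Finset.sum_sub_distrib, ← Finset.sum_mul,
      ← Finset.mul_sum, Finset.sum_const, Finset.card_univ, Fintype.card_fin, nsmul_eq_mul]
    field_simp
    ring
  have h1 : ∑ i, x i ^ 2 ≤ N * ‖x‖ ^ 2 := by
    have : ∑ i, x i ^ 2 ≤ ∑ _i : Fin N, ‖x‖ ^ 2 := Finset.sum_le_sum fun i _ =>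
      sq_le_sq' (by linarith [neg_abs_le (x i), norm_le_pi_norm x i, Real.norm_eq_abs (x i)])
        ((le_abs_self _).trans (norm_le_pi_norm x i))
    simpa using this
  have : 0 ≤ (∑ j, x j) ^ 2 / N := by positivity
  linarith

/-- Exponential decay, up to a constant rotation, of small perturbations of a rigidly rotating
configuration inside a quarter circle. -/
theorem exists_decay_estimate [NeZero N] (hγ : 0 < γ) {θ : Fin N → ℝ} {m : ℝ}
    (hθ : ∀ i j, θ i - θ j < Real.pi / 2) (hf : field γ ω θ = fun _ => m) :
    ∃ k > 0, ∃ r₀ > 0, ∀ r, 0 < r → r ≤ r₀ → ∀ ψ : ℝ → Fin N → ℝ, IsSolution γ ω ψ →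
      N * ‖ψ 0 - θ‖ ^ 2 ≤ r → ∃ c : ℝ, ∀ t, 0 ≤ t →
        ‖ψ t - (θ + fun _ => m * t) - (fun _ => c)‖ ≤ √(r * Real.exp (-k * t)) := by
  have hN : (0 : ℝ) < N := Nat.cast_pos.2 (NeZero.pos N)
  obtain ⟨p, hp⟩ := Finite.exists_max (fun p : Fin N × Fin N => θ p.1 - θ p.2)
  set α : ℝ := θ p.1 - θ p.2 with hα
  have hα2 : α < Real.pi / 2 := hθ _ _
  have hα0 : 0 ≤ α := by simpa using hp (0, 0)
  -- Half the gap to `π/2`: perturbations with coordinates at most `d / 2` change differences by at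
  -- most `d`, keeping them within `β < π/2`.
  set d : ℝ := (Real.pi / 2 - α) / 2 with hd
  have hdpos : 0 < d := by rw [hd]; linarith
  set β : ℝ := α + d with hβ
  have hβ2 : β < Real.pi / 2 := by rw [hβ, hd]; linarith
  have hcos : 0 < Real.cos β := Real.cos_pos_of_mem_Ioo ⟨by linarith [Real.pi_pos], hβ2⟩
  have hθα : ∀ i j, |θ j - θ i| ≤ α := fun i j =>
    abs_le.2 ⟨by linarith [hp (i, j)], hp (j, i)⟩
  refine ⟨γ * Real.cos β, by positivity, (d / 2) ^ 2, by positivity,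
    fun r hr hr0 ψ hψ hstart => ?_⟩
  -- The final rotation is the initial mean offset: the field has the same sum everywhere, so this
  -- offset is conserved and `u` stays centred.
  set c : ℝ := (∑ i, (ψ 0 - θ) i) / N with hc
  refine ⟨c, fun t ht => ?_⟩
  set u : ℝ → Fin N → ℝ := fun t => ψ t - (θ + fun _ => m * t) - (fun _ => c) with hu
  have hψu : ∀ t, field γ ω (ψ t) = field γ ω (θ + u t) := fun t => by
    rw [← field_add_const γ ω (θ + u t) (m * t + c)]
    congr 1; ext i; simp only [hu, Pi.add_apply, Pi.sub_apply]; ring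
  have hud : ∀ t i, HasDerivAt (fun t => u t i) (field γ ω (θ + u t) i - field γ ω θ i) t := by
    intro t i
    have h1 := hasDerivAt_pi.1 (hψ t) i
    have h2 : HasDerivAt (fun t : ℝ => θ i + m * t) m t := by
      simpa using ((hasDerivAt_id t).const_mul m).const_add (θ i)
    have h3 := (h1.sub h2).sub_const c
    rw [hψu t] at h3
    rw [hf]
    exact h3
  have hsum : ∀ t, ∑ i, u t i = 0 := by
    have hder : ∀ t, HasDerivAt (fun t => ∑ i, u t i) 0 t := fun t => by
      have h := HasDerivAt.fun_sum fun i (_ : i ∈ Finset.univ) => hud t i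
      rwa [Finset.sum_sub_distrib, sum_field, sum_field, sub_self] at h
    intro t
    have hconst := is_const_of_deriv_eq_zero (fun t => (hder t).differentiableAt)
      (fun t => (hder t).deriv) t 0
    rw [hconst]
    have e : ∀ i, u 0 i = (ψ 0 - θ) i - c := fun i => by simp [hu]
    simp only [e, Finset.sum_sub_distrib, Finset.sum_const, Finset.card_univ, Fintype.card_fin,
      nsmul_eq_mul]
    rw [hc]
    simp only [Pi.sub_apply, Finset.sum_sub_distrib]
    field_simp
    ring
  have hV : ∀ t, HasDerivAt (fun t => ∑ i, u t i ^ 2)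
      (2 * ∑ i, u t i * (field γ ω (θ + u t) i - field γ ω θ i)) t := fun t => by
    refine (HasDerivAt.fun_sum fun i (_ : i ∈ Finset.univ) => (hud t i).pow 2).congr_deriv ?_
    rw [Finset.mul_sum]
    exact Finset.sum_congr rfl fun i _ => by simp; ring
  have hdecay : ∀ t, ∑ i, u t i ^ 2 ≤ r →
      2 * ∑ i, u t i * (field γ ω (θ + u t) i - field γ ω θ i)
        ≤ -(2 * (γ * Real.cos β)) * ∑ i, u t i ^ 2 := by
    intro t hVt
    have hsmall : ∀ i, |u t i| ≤ d / 2 := fun i =>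
      (abs_le_sqrt_sum_sq (u t) i).trans
        (Real.sqrt_le_iff.2 ⟨by positivity, hVt.trans hr0⟩)
    have := sum_mul_field_sub_le (ω := ω) hγ.le hβ2.le (u := u t)
      (fun i j => (hθα i j).trans (by linarith))
      (fun i j => by
        have h1 := abs_add_le (θ j - θ i) (u t j - u t i)
        have h2 := abs_sub (u t j) (u t i)
        linarith [hθα i j, hsmall i, hsmall j]) (hsum t)
    linarith
  have hV0 : ∑ i, u 0 i ^ 2 ≤ r := by
    have e : ∀ i, u 0 i = (ψ 0 - θ) i - (∑ j, (ψ 0 - θ) j) / N := fun i => by simp [hu, hc]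
    simp only [e]
    exact (sum_sq_sub_mean_le (ψ 0 - θ)).trans hstart
  have hfin := le_exp_of_deriv_le hV (by positivity) hr hdecay hV0 ht
  rw [mul_div_cancel_left₀ _ (two_ne_zero' ℝ)] at hfin
  exact (norm_le_sqrt_sum_sq (u t)).trans (Real.sqrt_le_sqrt hfin)

/-- Rigidly rotating configurations inside a quarter circle are asymptotically orbitally
stable. -/
theorem isOrbitallyStable_of_quarter [NeZero N] (hγ : 0 < γ) {θ : Fin N → ℝ} {m : ℝ}
    (hθ : ∀ i j, θ i - θ j < Real.pi / 2) (hf : field γ ω θ = fun _ => m) :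
    IsOrbitallyStable γ ω (fun t => θ + fun _ => m * t) := by
  have hN : (0 : ℝ) < N := Nat.cast_pos.2 (NeZero.pos N)
  obtain ⟨k, hk, r₀, hr₀, H⟩ := exists_decay_estimate hγ hθ hf
  have hstart : ∀ r > 0, ∀ ψ : ℝ → Fin N → ℝ,
      ‖ψ 0 - (θ + fun _ => m * 0)‖ < √(r / N) → N * ‖ψ 0 - θ‖ ^ 2 ≤ r := by
    intro r hr ψ hψ
    have e : (θ + fun _ => m * 0) = θ := by ext; simp
    rw [e, Real.lt_sqrt (norm_nonneg _), lt_div_iff₀ hN] at hψ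
    linarith
  refine ⟨fun ε hε => ?_, ?_⟩
  · set r := min r₀ ((ε / 2) ^ 2) with hr
    have hr0 : 0 < r := lt_min hr₀ (by positivity)
    refine ⟨√(r / N), by positivity, fun ψ hψ hψ0 t ht => ?_⟩
    obtain ⟨c, hc⟩ := H r hr0 (min_le_left _ _) ψ hψ (hstart r hr0 ψ hψ0)
    refine ⟨c, (hc t ht).trans_lt ?_⟩
    have h1 : r * Real.exp (-k * t) ≤ (ε / 2) ^ 2 := by
      have : Real.exp (-k * t) ≤ 1 := Real.exp_le_one_iff.2 (by nlinarith)
      calc r * Real.exp (-k * t) ≤ r * 1 := by gcongr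
        _ ≤ (ε / 2) ^ 2 := by rw [mul_one]; exact min_le_right _ _
    exact (Real.sqrt_le_iff.2 ⟨by positivity, h1⟩).trans_lt (by linarith)
  · refine ⟨√(r₀ / N), by positivity, fun ψ hψ hψ0 => ?_⟩
    obtain ⟨c, hc⟩ := H r₀ hr₀ le_rfl ψ hψ (hstart r₀ hr₀ ψ hψ0)
    refine ⟨c, ?_⟩
    rw [tendsto_iff_norm_sub_tendsto_zero]
    have hlim : Tendsto (fun t : ℝ => √(r₀ * Real.exp (-k * t))) atTop (𝓝 0) := by
      have h1 : Tendsto (fun t : ℝ => -k * t) atTop atBot :=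
        tendsto_id.const_mul_atTop_of_neg (by linarith)
      have h2 := ((Real.tendsto_exp_atBot.comp h1).const_mul r₀).sqrt
      simpa using h2
    refine squeeze_zero' (Eventually.of_forall fun t => norm_nonneg _) ?_ hlim
    filter_upwards [eventually_ge_atTop 0] with t ht
    exact hc t ht

end Lyapunov

/-- A coupling strength above the range of the frequencies yields a stable phase-locked
solution. -/
theorem mem_stablyLockedSet_of_spread_lt {N : ℕ} [NeZero N] {γ : ℝ} {ω : Fin N → ℝ}
    (h : spread ω < γ) : ω ∈ stablyLockedSet N γ := by
  have hγ : 0 < γ := (spread_nonneg ω).trans_lt h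
  obtain ⟨θ, m, hθ, hf⟩ := exists_field_eq_const fun i j => (sub_le_spread ω i j).trans_lt h
  refine ⟨_, isPhaseLocked_of_field_eq_const hf, ?_, isOrbitallyStable_of_quarter hγ hθ hf⟩
  exact isSpectrallyStable_of_quarter hγ ω fun i j => by simpa using hθ i j

lemma stablyLockedSet_subset_lockedSet (N : ℕ) (γ : ℝ) :
    stablyLockedSet N γ ⊆ lockedSet N γ :=
  fun _ ⟨θ, hθ, _⟩ => ⟨θ, hθ⟩

/-! ### From range bounds to probabilities -/

section Probability

variable {Ω : Type*} [MeasurableSpace Ω] {P : Measure Ω} {X : ℕ → Ω → ℝ} {ξ : ℕ → ℝ}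

/-- The scale of a min-max concentrated sequence is eventually positive. -/
lemma IsMinMaxConcentrated.eventually_pos [IsProbabilityMeasure P]
    (h : IsMinMaxConcentrated P X ξ) : ∀ᶠ N in atTop, 0 < ξ N := by
  have h1 := tendstoInMeasure_iff_dist.1 h 1 one_pos
  filter_upwards [h1.eventually_lt_const (zero_lt_one)] with N hN
  by_contra hneg
  have huniv : {w | 1 ≤ dist (spread (sample X N w) / ξ N) 1} = Set.univ := by
    refine Set.eq_univ_of_forall fun w => ?_
    have : spread (sample X N w) / ξ N ≤ 0 :=
      div_nonpos_of_nonneg_of_nonpos (spread_nonneg _) (not_lt.1 hneg)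
    simp only [Set.mem_ofPred_eq, Real.dist_eq]
    rw [abs_sub_comm]
    exact (by linarith : (1 : ℝ) ≤ 1 - spread (sample X N w) / ξ N).trans (le_abs_self _)
  rw [huniv, measure_univ] at hN
  exact lt_irrefl _ hN

theorem tendsto_lockProb_zero [IsProbabilityMeasure P] (hξ : IsMinMaxConcentrated P X ξ)
    {γ : ℕ → ℝ} (hγ : ∀ N, 0 ≤ γ N)
    (h : limsup (fun N => ((γ N / ξ N : ℝ) : EReal)) atTop < ((1 / 2 : ℝ) : EReal)) :
    Tendsto (fun N => lockProb P X N (γ N)) atTop (𝓝 0) := by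
  obtain ⟨b, hb1, hb2⟩ := EReal.lt_iff_exists_real_btwn.1 h
  have hb2 : b < 1 / 2 := EReal.coe_lt_coe_iff.1 hb2
  -- Locking forces the normalised range to be at most `2γ/ξ < 2b < 1`, a deviation of at least `1 -
  -- 2b`.
  have hlim := tendstoInMeasure_iff_dist.1 hξ (1 - 2 * b) (by linarith)
  refine tendsto_of_tendsto_of_tendsto_of_le_of_le' tendsto_const_nhds hlim
    (Eventually.of_forall fun _ => zero_le) ?_
  filter_upwards [eventually_lt_of_limsup_lt hb1, hξ.eventually_pos] with N hN hpos
  refine measure_mono fun w hw => ?_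
  have h1 := spread_le_of_mem_lockedSet (hγ N) hw
  have h2 : γ N / ξ N < b := EReal.coe_lt_coe_iff.1 hN
  have h3 : spread (sample X N w) / ξ N ≤ 2 * b := by
    rw [div_le_iff₀ hpos]
    rw [div_lt_iff₀ hpos] at h2
    linarith
  simp only [Set.mem_ofPred_eq, Real.dist_eq]
  rw [abs_sub_comm]
  exact (by linarith : 1 - 2 * b ≤ 1 - spread (sample X N w) / ξ N).trans (le_abs_self _)

/-- The lower limit is taken in `EReal`, so an unbounded ratio is allowed. -/
theorem tendsto_stableLockProb_one [IsProbabilityMeasure P] (hξ : IsMinMaxConcentrated P X ξ)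
    {γ : ℕ → ℝ} (h : ((1 : ℝ) : EReal) < liminf (fun N => ((γ N / ξ N : ℝ) : EReal)) atTop) :
    Tendsto (fun N => stableLockProb P X N (γ N)) atTop (𝓝 1) := by
  obtain ⟨b, hb1, hb2⟩ := EReal.lt_iff_exists_real_btwn.1 h
  have hb1 : 1 < b := EReal.coe_lt_coe_iff.1 hb1
  have hlim := tendstoInMeasure_iff_dist.1 hξ (b - 1) (by linarith)
  have hlim' := ENNReal.Tendsto.sub (tendsto_const_nhds (x := (1 : ENNReal))) hlim
    (Or.inl ENNReal.one_ne_top)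
  rw [tsub_zero] at hlim'
  refine tendsto_of_tendsto_of_tendsto_of_le_of_le' hlim' tendsto_const_nhds ?_
    (Eventually.of_forall fun _ => prob_le_one)
  filter_upwards [eventually_lt_of_lt_liminf hb2, hξ.eventually_pos, eventually_gt_atTop 0]
    with N hN hpos hN0
  have : NeZero N := ⟨hN0.ne'⟩
  have h2 : b < γ N / ξ N := EReal.coe_lt_coe_iff.1 hN
  -- Covering the whole space by the locking event and the deviation event uses only subadditivity,
  -- so the locking event need not be shown measurable.
  rw [tsub_le_iff_right, ← measure_univ (μ := P)]
  refine (measure_mono fun w _ => ?_).trans (measure_union_le _ _)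
  by_cases hw : b - 1 ≤ dist (spread (sample X N w) / ξ N) 1
  · exact Or.inr hw
  · refine Or.inl (mem_stablyLockedSet_of_spread_lt ?_)
    rw [not_le, Real.dist_eq] at hw
    have h3 : spread (sample X N w) / ξ N < γ N / ξ N := by linarith [(abs_lt.1 hw).2]
    exact (div_lt_div_iff_of_pos_right hpos).1 h3

lemma stableLockProb_le_lockProb (P : Measure Ω) (X : ℕ → Ω → ℝ) (N : ℕ) (γ : ℝ) :
    stableLockProb P X N γ ≤ lockProb P X N γ :=
  measure_mono fun _ hw => stablyLockedSet_subset_lockedSet N γ hw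

end Probability

end Kuramoto

theorem mainTheorem2 {Ω : Type*} [MeasurableSpace Ω] (P : Measure Ω) [IsProbabilityMeasure P]
    (X : ℕ → Ω → ℝ) (hindep : iIndepFun X P) (hident : ∀ i, IdentDistrib (X i) (X 0) P P)
    (ξ : ℕ → ℝ) (hξ : Kuramoto.IsMinMaxConcentrated P X ξ)
    (γ : ℕ → ℝ) (hγ : ∀ N, 0 ≤ γ N) :
    (limsup (fun N => ((γ N / ξ N : ℝ) : EReal)) atTop < ((1 / 2 : ℝ) : EReal) →
      Tendsto (fun N => Kuramoto.lockProb P X N (γ N)) atTop (𝓝 0) ∧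
      Tendsto (fun N => Kuramoto.stableLockProb P X N (γ N)) atTop (𝓝 0)) ∧
    (((1 : ℝ) : EReal) < liminf (fun N => ((γ N / ξ N : ℝ) : EReal)) atTop →
      Tendsto (fun N => Kuramoto.lockProb P X N (γ N)) atTop (𝓝 1) ∧
      Tendsto (fun N => Kuramoto.stableLockProb P X N (γ N)) atTop (𝓝 1)) := by
  refine ⟨fun h => ?_, fun h => ?_⟩
  · have h0 := Kuramoto.tendsto_lockProb_zero hξ hγ h
    exact ⟨h0, tendsto_of_tendsto_of_tendsto_of_le_of_le tendsto_const_nhds h0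
      (fun _ => zero_le) fun N => Kuramoto.stableLockProb_le_lockProb P X N (γ N)⟩
  · have h1 := Kuramoto.tendsto_stableLockProb_one hξ h
    exact ⟨tendsto_of_tendsto_of_tendsto_of_le_of_le h1 tendsto_const_nhds
      (fun N => Kuramoto.stableLockProb_le_lockProb P X N (γ N)) fun _ => prob_le_one, h1⟩
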